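/- **Theorem 1.1.** Let $0<p<1$. For every $N\ge 1$ let $A_N^{(r)}$, $r=1,2,\dots$, be real symmetric $N\times N$ random matrices on a common probability space (which may depend on $N$), with entries $[A_N^{(r)}]_{ij}=N^{-1/2}a^{(r)}_{ij}$, where $\{a^{(r)}_{ij}: r\ge 1,\ 1\le i\le j\le N\}$ is a jointly Gaussian family with mean zero and covariance $$\mathbf E\,a^{(r)}_{ij}a^{(r')}_{i'j'}=p^{|r-r'|}\big(\delta_{ii'}\delta_{jj'}+\delta_{ij'}\delta_{i'j}\big).$$ For $k\ge 0$ put $$B_k(p)=\sum_{\omega}\ \prod_{(i,j)\in\omega}p^{|i-j|},$$ where $\omega$ runs over the non-crossing pairings of $\{1,\dots,2k\}$. Then: 1. For every $k\ge 0$ the random variable $\frac1N\operatorname{Tr}\big(A_N^{(1)}A_N^{(2)}\cdots A_N^{(2k)}\big)$ is integrable, and $$\lim_{N\to\infty}\frac1N\,\mathbf E\operatorname{Tr}\big(A_N^{(1)}A_N^{(2)}\cdots A_N^{(2k)}\big)=B_k(p).$$ 2. $B_0(p)=1$ and, for all $k\ge 0$, $$B_{k+1}(p)=\sum_{i=1}^{k+1}p^{2i-1}B_{i-1}(p)\,B_{k+1-i}(p).$$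 3. For all $k\ge 0$, $B_k(p)=p^{k}\phi_k(p^2)$, where the $\phi_k$ are determined by $\phi_0(x)=1$ and $$\phi_{k+1}(x)=\sum_{i=1}^{k+1}x^{\,i-1}\phi_{i-1}(x)\,\phi_{k+1-i}(x)\qquad(k\ge 0),$$ so that in particular $\phi_1(x)=1$. 4. For all $k\ge 0$, with $q=p^{-1}$, one has $p^{-\binom k2}\phi_k(p)=C_k(q)$, where the $C_k(q)$ are the (Carlitz–Riordan) $q$-Catalan numbers, defined by $C_0(q)=1$ and $C_{n+1}(q)=\sum_{i=0}^{n}q^{(i+1)(n-i)}C_i(q)\,C_{n-i}(q)$. -/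

import Mathlib

open MeasureTheory ProbabilityTheory Filter Topology

/-- `a r i j` (`r ≥ 1`, `i, j < N`) are the unnormalized entries of a sequence of real symmetric
`N × N` matrices: the whole family is jointly Gaussian and centred, with covariance
`E (a r i j * a r' i' j') = V (r - r') * (δ_{ii'} δ_{jj'} + δ_{ij'} δ_{i'j})`. -/
structure IsCorrelatedGOE {Ω : Type*} [MeasurableSpace Ω] (P : Measure Ω) (V : ℤ → ℝ) (N : ℕ)
    (a : ℕ+ → Fin N → Fin N → Ω → ℝ) : Prop where
  symm : ∀ r i j ω, a r i j ω = a r j i ω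
  gaussian : IsGaussianProcess
    (fun (t : {t : ℕ+ × Fin N × Fin N // t.2.1 ≤ t.2.2}) => a t.1.1 t.1.2.1 t.1.2.2) P
  mean_zero : ∀ r i j, ∫ ω, a r i j ω ∂P = 0
  covariance : ∀ (r r' : ℕ+) (i j i' j' : Fin N),
    ∫ ω, a r i j ω * a r' i' j' ω ∂P =
      V (((r : ℕ) : ℤ) - ((r' : ℕ) : ℤ)) *
        ((if i = i' then 1 else 0) * (if j = j' then 1 else 0) +
          (if i = j' then 1 else 0) * (if i' = j then 1 else 0))

/-- The random matrix `A^{(r)} = N^{-1/2} (a r i j)_{i,j}`. -/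
noncomputable def normalizedMatrix {Ω : Type*} {N : ℕ} (a : ℕ+ → Fin N → Fin N → Ω → ℝ)
    (r : ℕ+) (ω : Ω) : Matrix (Fin N) (Fin N) ℝ :=
  Matrix.of fun i j => (1 / Real.sqrt N) * a r i j ω

/-- The normalized trace `(1/N) Tr (A^{(1)} A^{(2)} ⋯ A^{(m)})`. -/
noncomputable def normalizedTraceProd {Ω : Type*} {N : ℕ} (a : ℕ+ → Fin N → Fin N → Ω → ℝ)
    (m : ℕ) (ω : Ω) : ℝ :=
  (1 / (N : ℝ)) *
    (List.ofFn fun s : Fin m => normalizedMatrix a (Nat.succPNat s) ω).prod.trace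

/-- `w` is a non-crossing pairing of `{1, …, n}`, given as the set of its pairs `(i, j)`, `i < j`:
every point lies in exactly one pair, and no two pairs satisfy `i < i' < j < j'`. -/
def IsNonCrossingPairing (n : ℕ) (w : Finset (ℕ × ℕ)) : Prop :=
  (∀ e ∈ w, 1 ≤ e.1 ∧ e.1 < e.2 ∧ e.2 ≤ n) ∧
  (∀ x ∈ Finset.Icc 1 n, (w.filter fun e => e.1 = x ∨ e.2 = x).card = 1) ∧
  (∀ e ∈ w, ∀ f ∈ w, ¬ (e.1 < f.1 ∧ f.1 < e.2 ∧ e.2 < f.2))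

instance (n : ℕ) : DecidablePred (IsNonCrossingPairing n) := fun w => by
  unfold IsNonCrossingPairing; infer_instance

/-- The finite set of all non-crossing pairings of `{1, …, n}`. -/
def nonCrossingPairings (n : ℕ) : Finset (Finset (ℕ × ℕ)) :=
  (Finset.Icc 1 n ×ˢ Finset.Icc 1 n).powerset.filter (IsNonCrossingPairing n)

/-- `B_k(p)`: the sum over the non-crossing pairings of `{1, …, 2k}` of the product of
`p ^ |i - j|` over the pairs `(i, j)`; here `i < j`, so that `|i - j| = j - i`. -/
noncomputable def pairingSum (k : ℕ) (p : ℝ) : ℝ :=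
  ∑ w ∈ nonCrossingPairings (2 * k), ∏ e ∈ w, p ^ (e.2 - e.1)

/-- `φ_k(x)`: `φ_0(x) = 1` and
`φ_{k+1}(x) = ∑_{i=1}^{k+1} x ^ (i-1) φ_{i-1}(x) φ_{k+1-i}(x)`
(the summation index below is `i - 1`); in particular `φ_1(x) = 1`. -/
noncomputable def phi : ℕ → ℝ → ℝ
  | 0, _ => 1
  | k + 1, x => ∑ i : Fin (k + 1), x ^ (i : ℕ) * phi i x * phi (k - i) x

/-- The (Carlitz–Riordan) `q`-Catalan numbers: `C_0(q) = 1` and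
`C_{n+1}(q) = ∑_{i=0}^{n} q ^ ((i+1)(n-i)) C_i(q) C_{n-i}(q)`. -/
noncomputable def qCatalan : ℕ → ℝ → ℝ
  | 0, _ => 1
  | n + 1, q => ∑ i : Fin (n + 1), q ^ (((i : ℕ) + 1) * (n - i)) * qCatalan i q * qCatalan (n - i) q

/-! Gaussian integration by parts gives moments of traces a closed system of loop (Schwinger–Dyson)
equations, and their leading order is the recursion obeyed by non-crossing pairings. For a centred
Gaussian family, `E[X_t F] = E[∂_t F]` for polynomials `F`, where `∂_t X_s = E[X_t X_s]`
(`expectation_X_mul`). Applied to the first letter of a normalized trace, multiplied by further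
traces, it pairs that letter with every other one (`loop_equation`). Pairing within the same trace
splits it in two at order 1, or fuses the pieces with one reversed at order `1/N`; pairing with
another trace costs `1/N²`. Thus only splittings survive, and induction on the total length shows
that moments of products of traces converge to products of `wordLimit` (`tendsto_of_loop_equation`).
No separate variance estimate is needed, since factorization is part of the induction. For
consecutive letters the covariance depends only on index differences, so the limit depends only on
the length. Splitting a non-crossing pairing at the partner of its first point gives the same
recursion (`pairingGF_succ`), whence the limit is `pairingSum`. The relations with `phi` and
`qCatalan` follow by comparing recursions and counting exponents. -/

/-! ### Gaussian integration by parts for polynomials. -/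

section GaussianIntegrationByParts

open MvPolynomial

/-- The function is the moment generating function of `N(0, v)`; at `t = 0` this becomes the
recursion for its moments. It is `f' = v t f` differentiated `n` times. For `n = 0` the truncated `n
- 1` carries the factor 0. -/
lemma iteratedDeriv_exp_mul_sq_div_two (v : ℝ) (n : ℕ) (t : ℝ) :
    iteratedDeriv (n + 1) (fun t : ℝ => Real.exp (v * t ^ 2 / 2)) t =
      v * t * iteratedDeriv n (fun t : ℝ => Real.exp (v * t ^ 2 / 2)) t +
        n * v * iteratedDeriv (n - 1) (fun t : ℝ => Real.exp (v * t ^ 2 / 2)) t := by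
  set f : ℝ → ℝ := fun t => Real.exp (v * t ^ 2 / 2) with hf
  have hc : ContDiff ℝ ⊤ f := by fun_prop
  have hd (n : ℕ) : Differentiable ℝ (iteratedDeriv n f) :=
    hc.differentiable_iteratedDeriv n (by exact_mod_cast WithTop.coe_lt_top _)
  induction n generalizing t with
  | zero =>
    have h : HasDerivAt f (v * t * f t) t := by
      have h1 : HasDerivAt (fun t : ℝ => v * t ^ 2 / 2) (v * t) t := by
        have := ((hasDerivAt_pow 2 t).const_mul v).div_const 2
        convert! this using 1
        norm_num
        ring
      convert! h1.exp using 1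
      simp only [hf]
      ring
    simp [h.deriv]
  | succ n ih =>
    have hfun : iteratedDeriv (n + 1) f = fun t =>
        v * t * iteratedDeriv n f t + n * v * iteratedDeriv (n - 1) f t := funext ih
    have h1 : HasDerivAt (iteratedDeriv n f) (iteratedDeriv (n + 1) f t) t := by
      rw [iteratedDeriv_succ]; exact (hd n t).hasDerivAt
    have h2 : HasDerivAt (iteratedDeriv (n - 1) f) (iteratedDeriv (n - 1 + 1) f t) t := by
      rw [iteratedDeriv_succ]; exact (hd (n - 1) t).hasDerivAt
    have h3 := (((hasDerivAt_id t).const_mul v).mul h1).add (h2.const_mul ((n : ℝ) * v))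
    rw [iteratedDeriv_succ]
    have h4 := h3.congr_of_eventuallyEq (f₁ := iteratedDeriv (n + 1) f)
      (Eventually.of_forall fun t => by simp [ih t])
    rw [h4.deriv]
    rcases n with _ | n
    · simp; ring
    · simp; ring

lemma integral_pow_succ_gaussianReal (v : NNReal) (n : ℕ) :
    ∫ x, x ^ (n + 1) ∂gaussianReal 0 v = n * v * ∫ x, x ^ (n - 1) ∂gaussianReal 0 v := by
  have h (m : ℕ) : ∫ x, x ^ m ∂gaussianReal 0 v =
      iteratedDeriv m (fun t : ℝ => Real.exp ((v : ℝ) * t ^ 2 / 2)) 0 := by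
    have := iteratedDeriv_mgf_zero (X := id) (μ := gaussianReal 0 v)
      (by simp [integrableExpSet_id_gaussianReal]) m
    rw [mgf_id_gaussianReal] at this
    simpa using this.symm
  rw [h, h, iteratedDeriv_exp_mul_sq_div_two]
  simp

variable {Ω σ : Type*} [MeasurableSpace Ω] {P : Measure Ω} {X : σ → Ω → ℝ}

/-- The exponent must vary in the induction: by Hölder, a product is in `L^q` once both factors are
in `L^{2q}`. -/
lemma ProbabilityTheory.IsGaussianProcess.memLp_eval (hX : IsGaussianProcess X P)
    (F : MvPolynomial σ ℝ) (q : NNReal) :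
    MemLp (fun ω => eval (fun s => X s ω) F) q P := by
  have := hX.isProbabilityMeasure
  induction F using MvPolynomial.induction_on generalizing q with
  | C a => simpa using memLp_const a
  | add F G hF hG => simpa using! (hF q).add (hG q)
  | mul_X F s hF =>
    have h1 := hF (2 * q)
    have h2 : MemLp (X s) (2 * q : NNReal) P :=
      (hX.hasGaussianLaw_eval s).memLp ENNReal.coe_ne_top
    have : ENNReal.HolderTriple ((2 * q : NNReal) : ENNReal) ((2 * q : NNReal) : ENNReal) q := by
      constructor
      push_cast
      rw [ENNReal.mul_inv (by simp) (by simp), ← add_mul, ENNReal.inv_two_add_inv_two, one_mul]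
    simpa using! h2.mul' h1

lemma ProbabilityTheory.IsGaussianProcess.integrable_eval (hX : IsGaussianProcess X P)
    (F : MvPolynomial σ ℝ) : Integrable (fun ω => eval (fun s => X s ω) F) P :=
  memLp_one_iff_integrable.1 (by simpa using hX.memLp_eval F 1)

/-- The expectation of a polynomial in the variables of a Gaussian process. -/
noncomputable def ProbabilityTheory.IsGaussianProcess.expectation (hX : IsGaussianProcess X P) :
    MvPolynomial σ ℝ →ₗ[ℝ] ℝ where
  toFun F := ∫ ω, eval (fun s => X s ω) F ∂P
  map_add' F G := by
    simp only [map_add]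
    exact integral_add (hX.integrable_eval F) (hX.integrable_eval G)
  map_smul' c F := by
    simp only [smul_eval, RingHom.id_apply, smul_eq_mul]
    exact integral_const_mul _ _

/-- The derivation `∂_t` of the polynomial ring with `∂_t X_s = E[X_t X_s]`. -/
noncomputable def covDerivation (P : Measure Ω) (X : σ → Ω → ℝ) (t : σ) :
    Derivation ℝ (MvPolynomial σ ℝ) (MvPolynomial σ ℝ) :=
  mkDerivation ℝ fun s => C (∫ ω, X t ω * X s ω ∂P)

/-- The part of `X_s` that is uncorrelated with `X_t`, as a polynomial. -/
noncomputable def gaussResidual (P : Measure Ω) (X : σ → Ω → ℝ) (t s : σ) : MvPolynomial σ ℝ :=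
  MvPolynomial.X s -
    C ((∫ ω, X t ω * X s ω ∂P) / (∫ ω, X t ω * X t ω ∂P)) * MvPolynomial.X t

/-- This covers zero variance, where the quotient is 0 by convention: then `X t` vanishes almost
everywhere, and so does the covariance. -/
lemma ProbabilityTheory.IsGaussianProcess.cov_mul_div_var (hX : IsGaussianProcess X P) (t s : σ) :
    (∫ ω, X t ω * X s ω ∂P) / (∫ ω, X t ω * X t ω ∂P) * (∫ ω, X t ω * X t ω ∂P) =
      ∫ ω, X t ω * X s ω ∂P := by
  by_cases h : ∫ ω, X t ω * X t ω ∂P = 0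
  · rw [h, mul_zero]
    have hi : Integrable (fun ω => X t ω * X t ω) P := by
      exact (hX.integrable_eval (MvPolynomial.X t * MvPolynomial.X t)).congr
        (ae_of_all _ fun ω => by simp)
    rw [integral_eq_zero_iff_of_nonneg (fun ω => mul_self_nonneg _) hi] at h
    symm
    apply integral_eq_zero_of_ae
    filter_upwards [h] with ω hω
    have : X t ω = 0 := by simpa using hω
    simp [this]
  · exact div_mul_cancel₀ _ h

lemma ProbabilityTheory.IsGaussianProcess.covDerivation_residual (hX : IsGaussianProcess X P)
    (t s : σ) : covDerivation P X t (gaussResidual P X t s) = 0 := by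
  have := hX.cov_mul_div_var t s
  simp only [gaussResidual, covDerivation, map_sub, ← smul_eq_C_mul, Derivation.map_smul,
    mkDerivation_X]
  rw [smul_eq_C_mul, ← C_mul, this, sub_self]

lemma ProbabilityTheory.IsGaussianProcess.covDerivation_list_prod_residual
    (hX : IsGaussianProcess X P) (t : σ) (l : List σ) :
    covDerivation P X t (l.map (gaussResidual P X t)).prod = 0 := by
  induction l with
  | nil => simp
  | cons s l ih => simp [Derivation.leibniz, hX.covDerivation_residual, ih]

/-- Uncorrelated jointly Gaussian families are independent. Independence from all residuals jointly
is what allows products of residuals to be factored out of expectations. -/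
lemma ProbabilityTheory.IsGaussianProcess.indepFun_residual (hX : IsGaussianProcess X P)
    (h0 : ∀ s, ∫ ω, X s ω ∂P = 0) (t : σ) :
    IndepFun (X t) (fun ω s => eval (fun s => X s ω) (gaussResidual P X t s)) P := by
  classical
  have := hX.isProbabilityMeasure
  set Y : σ → Ω → ℝ := fun s ω => eval (fun s => X s ω) (gaussResidual P X t s) with hY
  have hYs (s : σ) (ω : Ω) : Y s ω = X s ω -
      (∫ ω, X t ω * X s ω ∂P) / (∫ ω, X t ω * X t ω ∂P) * X t ω := by
    simp [hY, gaussResidual]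
  have hY0 (s : σ) : ∫ ω, Y s ω ∂P = 0 := by
    simp only [hYs]
    rw [integral_sub ((hX.hasGaussianLaw_eval s).integrable)
      ((hX.hasGaussianLaw_eval t).integrable.const_mul _), integral_const_mul, h0, h0]
    simp
  have hG : IsGaussianProcess (Sum.elim (fun _ : Unit => X t) Y) P := by
    refine hX.of_isGaussianProcess ?_
    rintro (_ | s)
    · exact ⟨{t}, ContinuousLinearMap.proj ⟨t, by simp⟩, fun ω => rfl⟩
    · refine ⟨{t, s}, ContinuousLinearMap.proj ⟨s, by simp⟩ -
        ((∫ ω, X t ω * X s ω ∂P) / (∫ ω, X t ω * X t ω ∂P)) •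
          ContinuousLinearMap.proj ⟨t, by simp⟩, fun ω => ?_⟩
      simp [hYs]
  have hind := hG.indepFun_of_covariance_eq_zero (fun _ => hX.aemeasurable t)
    (fun s => (hX.integrable_eval (gaussResidual P X t s)).aestronglyMeasurable.aemeasurable) ?_
  · exact hind.comp (φ := fun g : Unit → ℝ => g ()) (measurable_pi_apply ()) measurable_id
  · intro _ s
    rw [covariance_eq_sub ((hX.hasGaussianLaw_eval t).memLp_two)
      (by simpa using! hX.memLp_eval (gaussResidual P X t s) 2), h0]
    have e : X t * Y s = fun ω => X t ω * X s ω -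
        (∫ ω, X t ω * X s ω ∂P) / (∫ ω, X t ω * X t ω ∂P) * (X t ω * X t ω) := by
      ext ω; simp only [Pi.mul_apply, hYs]; ring
    have hi (s : σ) : Integrable (fun ω => X t ω * X s ω) P := by
      exact (hX.integrable_eval (MvPolynomial.X t * MvPolynomial.X s)).congr
        (ae_of_all _ fun ω => by simp)
    rw [e, integral_sub (hi s) ((hi t).const_mul _), integral_const_mul, hX.cov_mul_div_var]
    simp

lemma ProbabilityTheory.IsGaussianProcess.integral_pow_succ (hX : IsGaussianProcess X P)
    (h0 : ∀ s, ∫ ω, X s ω ∂P = 0) (t : σ) (k : ℕ) :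
    ∫ ω, X t ω ^ (k + 1) ∂P = k * (∫ ω, X t ω * X t ω ∂P) * ∫ ω, X t ω ^ (k - 1) ∂P := by
  have := hX.isProbabilityMeasure
  have hlaw := (hX.hasGaussianLaw_eval t).map_eq_gaussianReal
  rw [h0] at hlaw
  have hv : Var[X t; P] = ∫ ω, X t ω * X t ω ∂P := by
    rw [variance_eq_sub ((hX.hasGaussianLaw_eval t).memLp_two), h0]
    simp [pow_two]
  have hm (m : ℕ) : ∫ ω, X t ω ^ m ∂P = ∫ x, x ^ m ∂gaussianReal 0 Var[X t; P].toNNReal := by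
    rw [← hlaw, integral_map (hX.aemeasurable t) (by fun_prop)]
  rw [hm, hm, integral_pow_succ_gaussianReal, Real.coe_toNNReal _ (variance_nonneg _ _), hv]

lemma ProbabilityTheory.IsGaussianProcess.expectation_pow_mul_residual
    (hX : IsGaussianProcess X P) (h0 : ∀ s, ∫ ω, X s ω ∂P = 0) (t : σ) (k : ℕ) (l : List σ) :
    hX.expectation (MvPolynomial.X t ^ k * (l.map (gaussResidual P X t)).prod) =
      (∫ ω, X t ω ^ k ∂P) * hX.expectation (l.map (gaussResidual P X t)).prod := by
  have hl (ω : Ω) : eval (fun s => X s ω) (l.map (gaussResidual P X t)).prod =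
      (l.map fun s => eval (fun s => X s ω) (gaussResidual P X t s)).prod := by
    rw [map_list_prod, List.map_map]; rfl
  have hmeas : Measurable fun y : σ → ℝ => (l.map y).prod := by
    induction l with
    | nil => simp
    | cons s l ih => simpa using! (measurable_pi_apply s).mul (ih fun ω => by
        rw [map_list_prod, List.map_map]; rfl)
  have hind := (hX.indepFun_residual h0 t).comp (φ := fun x : ℝ => x ^ k) (by fun_prop) hmeas
  have e := hind.integral_mul_eq_mul_integral ?_ ?_
  · simpa [expectation, hl] using! e
  · exact ((hX.aemeasurable t).pow_const k).aestronglyMeasurable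
  · have := (hX.integrable_eval (l.map (gaussResidual P X t)).prod).aestronglyMeasurable
    simpa only [hl] using! this

/-- Gaussian integration by parts for polynomials. -/
theorem ProbabilityTheory.IsGaussianProcess.expectation_X_mul (hX : IsGaussianProcess X P)
    (h0 : ∀ s, ∫ ω, X s ω ∂P = 0) (t : σ) (F : MvPolynomial σ ℝ) :
    hX.expectation (MvPolynomial.X t * F) = hX.expectation (covDerivation P X t F) := by
  -- The prefix is an accumulator: each factor `X s` of `F` becomes `c X t` plus a residual, raising
  -- `k` or lengthening `l`. Once `F` is constant, `∂_t` kills the residuals, independence separates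
  -- them, and the one-variable recursion remains.
  suffices h : ∀ (k : ℕ) (l : List σ),
      hX.expectation (MvPolynomial.X t *
        (MvPolynomial.X t ^ k * (l.map (gaussResidual P X t)).prod * F)) =
      hX.expectation (covDerivation P X t
        (MvPolynomial.X t ^ k * (l.map (gaussResidual P X t)).prod * F)) by
    simpa using h 0 []
  induction F using MvPolynomial.induction_on with
  | C a =>
    intro k l
    have e1 : MvPolynomial.X t * (MvPolynomial.X t ^ k * (l.map (gaussResidual P X t)).prod * C a) =
        a • (MvPolynomial.X t ^ (k + 1) * (l.map (gaussResidual P X t)).prod) := by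
      rw [smul_eq_C_mul]; ring
    have e2 : covDerivation P X t (MvPolynomial.X t ^ k * (l.map (gaussResidual P X t)).prod * C a) =
        (a * (k * ∫ ω, X t ω * X t ω ∂P)) •
          (MvPolynomial.X t ^ (k - 1) * (l.map (gaussResidual P X t)).prod) := by
      rw [mul_comm _ (C a), ← smul_eq_C_mul, Derivation.map_smul, Derivation.leibniz,
        hX.covDerivation_list_prod_residual, smul_zero, zero_add, Derivation.leibniz_pow]
      simp only [covDerivation, mkDerivation_X, smul_eq_C_mul, C_mul, nsmul_eq_mul, smul_eq_mul,
        map_natCast]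
      ring
    rw [e1, e2, map_smul, map_smul, hX.expectation_pow_mul_residual h0,
      hX.expectation_pow_mul_residual h0, hX.integral_pow_succ h0]
    simp only [smul_eq_mul]
    ring
  | add F G hF hG =>
    intro k l
    simp only [mul_add, map_add, hF k l, hG k l]
  | mul_X F s hF =>
    intro k l
    set c : ℝ := (∫ ω, X t ω * X s ω ∂P) / (∫ ω, X t ω * X t ω ∂P) with hc
    have hs : (MvPolynomial.X s : MvPolynomial σ ℝ) =
        C c * MvPolynomial.X t + gaussResidual P X t s := by
      simp [gaussResidual, hc]
    have e : MvPolynomial.X t ^ k * (l.map (gaussResidual P X t)).prod * (F * MvPolynomial.X s) =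
        c • (MvPolynomial.X t ^ (k + 1) * (l.map (gaussResidual P X t)).prod * F) +
          MvPolynomial.X t ^ k * ((s :: l).map (gaussResidual P X t)).prod * F := by
      rw [hs, smul_eq_C_mul, List.map_cons, List.prod_cons]; ring
    rw [e, mul_add, mul_smul_comm]
    simp only [map_add, map_smul, Derivation.map_smul, hF (k + 1) l, hF k (s :: l)]

end GaussianIntegrationByParts

/-! ### The loop equation for words in symmetric matrices. -/

section LoopEquation

variable {I n R : Type*} [Fintype n] [DecidableEq n] [CommRing R]

/-- The matrix of a word. -/
def wordMatrix (M : I → Matrix n n R) (w : List I) : Matrix n n R := (w.map M).prod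

variable {M : I → Matrix n n R}

lemma wordMatrix_append (u v : List I) :
    wordMatrix M (u ++ v) = wordMatrix M u * wordMatrix M v := by
  simp [wordMatrix]

lemma wordMatrix_reverse (hM : ∀ r, (M r).transpose = M r) (w : List I) :
    wordMatrix M w.reverse = (wordMatrix M w).transpose := by
  induction w with
  | nil => simp [wordMatrix]
  | cons r w ih =>
    rw [List.reverse_cons, wordMatrix_append, ih]
    simp [wordMatrix, Matrix.transpose_mul, hM]

variable [Algebra ℝ R]

/-- The normalized trace of the matrix of a word. -/
noncomputable def wordTrace (M : I → Matrix n n R) (w : List I) : R :=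
  ((Fintype.card n : ℝ)⁻¹) • (wordMatrix M w).trace

lemma trace_wordMatrix [Nonempty n] (w : List I) :
    (wordMatrix M w).trace = (Fintype.card n : ℝ) • wordTrace M w := by
  rw [wordTrace, smul_smul, mul_inv_cancel₀ (by simp), one_smul]

lemma wordTrace_nil [Nonempty n] : wordTrace M [] = 1 := by
  have : (Fintype.card n : ℝ) ≠ 0 := by simp
  rw [wordTrace, wordMatrix]
  simp only [List.map_nil, List.prod_nil, Matrix.trace_one]
  rw [← map_natCast (algebraMap ℝ R), Algebra.smul_def, ← map_mul, inv_mul_cancel₀ this, map_one]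

/-- Differentiating the letter at position `s` replaces it by a multiple of `E_ij + E_ji`, the sum
of two matrix units, which cuts the product there. -/
lemma derivation_wordMatrix {c : I → ℝ} {i j : n} (D : Derivation ℝ R R)
    (hD : ∀ r k l, D (M r k l) = algebraMap ℝ R (c r *
      ((if i = k then 1 else 0) * (if j = l then 1 else 0) +
        (if i = l then 1 else 0) * (if k = j then 1 else 0)))) (w : List I) (k l : n) :
    D (wordMatrix M w k l) = ∑ s : Fin w.length, c (w.get s) •
      (wordMatrix M (w.take s) k i * wordMatrix M (w.drop (s + 1)) j l +
        wordMatrix M (w.take s) k j * wordMatrix M (w.drop (s + 1)) i l) := by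
  induction w generalizing k l with
  | nil =>
    simp only [wordMatrix, List.map_nil, List.prod_nil, Matrix.one_apply]
    split_ifs <;> simp
  | cons r w ih =>
    have e (w : List I) (k l : n) : wordMatrix M (r :: w) k l =
        ∑ m, M r k m * wordMatrix M w m l := by
      simp [wordMatrix, Matrix.mul_apply]
    have hone (k l : n) : wordMatrix M [] k l = if k = l then (1 : R) else 0 := by
      simp [wordMatrix, Matrix.one_apply]
    simp only [e, map_sum, Derivation.leibniz, ih, hD, smul_eq_mul, Finset.sum_add_distrib]
    refine Eq.trans ?_ (Fin.sum_univ_succ (n := w.length) _).symm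
    rw [add_comm]
    congr 1
    · simp only [List.get_eq_getElem, Fin.val_zero, List.getElem_cons_zero, List.take_zero, hone,
        List.drop_succ_cons, List.drop_zero, Algebra.smul_def, map_mul, map_add, zero_add,
        apply_ite (algebraMap ℝ R), map_one, map_zero, mul_add, Finset.sum_add_distrib]
      congr 1
      · rw [Finset.sum_eq_single j (by intro b _ hb; simp [hb.symm]) (by simp)]
        simp [eq_comm, mul_comm]
      · rw [Finset.sum_eq_single i (by intro b _ hb; simp [hb.symm]) (by simp)]
        simp [eq_comm, mul_comm]
    · simp only [Finset.mul_sum]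
      rw [Finset.sum_comm]
      refine Finset.sum_congr rfl fun s _ => ?_
      simp only [List.get_eq_getElem, Fin.val_succ, List.getElem_cons_succ, List.take_succ_cons,
        List.drop_succ_cons, e, Finset.sum_mul, ← Finset.sum_add_distrib, Finset.smul_sum]
      refine Finset.sum_congr rfl fun m _ => ?_
      simp only [Algebra.smul_def]
      ring

lemma derivation_list_prod {A : Type*} (D : Derivation ℝ R R) (f : A → R) (L : List A) :
    D (L.map f).prod = ∑ t : Fin L.length, ((L.eraseIdx t).map f).prod * D (f (L.get t)) := by
  induction L with
  | nil => simp
  | cons a L ih =>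
    refine Eq.trans ?_ (Fin.sum_univ_succ (n := L.length) _).symm
    simp only [List.map_cons, List.prod_cons, Derivation.leibniz, ih, smul_eq_mul, Fin.val_zero,
      List.eraseIdx_cons_zero, List.get_eq_getElem, List.getElem_cons_zero, Fin.val_succ,
      List.eraseIdx_cons_succ, List.getElem_cons_succ, Finset.mul_sum, mul_assoc]
    rw [add_comm]

/-- The Schwinger–Dyson equation for mixed moments of traces of words in symmetric matrices whose
entries satisfy the Gaussian integration by parts formula. -/
theorem loop_equation [Nonempty n] {V : I → I → ℝ} (hM : ∀ r, (M r).transpose = M r)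
    (D : I → n → n → Derivation ℝ R R)
    (hD : ∀ r i j r' k l, D r i j (M r' k l) =
      algebraMap ℝ R ((Fintype.card n : ℝ)⁻¹ * V r r' *
        ((if i = k then 1 else 0) * (if j = l then 1 else 0) +
          (if i = l then 1 else 0) * (if k = j then 1 else 0))))
    (E : R →ₗ[ℝ] ℝ) (hE : ∀ r i j F, E (M r i j * F) = E (D r i j F))
    (r : I) (w : List I) (L : List (List I)) :
    E (((r :: w) :: L).map (wordTrace M)).prod =
      ∑ s : Fin w.length, V r (w.get s) *
        (E ((w.take s :: w.drop (s + 1) :: L).map (wordTrace M)).prod +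
          (Fintype.card n : ℝ)⁻¹ *
            E (((w.take s ++ (w.drop (s + 1)).reverse) :: L).map (wordTrace M)).prod) +
      ((Fintype.card n : ℝ)⁻¹) ^ 2 * ∑ t : Fin L.length, ∑ s : Fin (L.get t).length,
        V r ((L.get t).get s) *
        (E (((w ++ (((L.get t).drop (s + 1)) ++ (L.get t).take s)) ::
            L.eraseIdx t).map (wordTrace M)).prod +
          E (((w ++ (((L.get t).drop (s + 1)) ++ (L.get t).take s).reverse) ::
            L.eraseIdx t).map (wordTrace M)).prod) := by
  set N : ℝ := (Fintype.card n : ℝ) with hN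
  have hN0 : N ≠ 0 := by simp [hN]
  have htr (w : List I) : (wordMatrix M w).trace = N • wordTrace M w := trace_wordMatrix w
  -- Equal index order in both factors amounts to a transpose, which for symmetric letters reverses
  -- the word.
  have hcross (v x : List I) : ∑ i, ∑ j, wordMatrix M v j i * wordMatrix M x j i =
      N • wordTrace M (v ++ x.reverse) := by
    rw [← htr, wordMatrix_append, wordMatrix_reverse hM, Finset.sum_comm]
    simp [Matrix.trace, Matrix.mul_apply]
  have hstraight (v x : List I) : ∑ i, ∑ j, wordMatrix M v j i * wordMatrix M x i j =
      N • wordTrace M (v ++ x) := by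
    rw [← htr, wordMatrix_append, Finset.sum_comm]
    simp [Matrix.trace, Matrix.mul_apply]
  have hself : ∑ i, ∑ j, D r i j (wordMatrix M w j i) =
      ∑ s : Fin w.length, (V r (w.get s)) •
        (wordTrace M (w.take s ++ (w.drop (s + 1)).reverse) +
          N • (wordTrace M (w.take s) * wordTrace M (w.drop (s + 1)))) := by
    have h (i j : n) := derivation_wordMatrix (D r i j) (c := fun r' => N⁻¹ * V r r')
      (fun r' k l => hD r i j r' k l) w j i
    simp only [h]
    simp_rw [Finset.sum_comm (s := (Finset.univ : Finset n)) (t := (Finset.univ : Finset (Fin _)))]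
    refine Finset.sum_congr rfl fun s _ => ?_
    simp only [← Finset.smul_sum, Finset.sum_add_distrib]
    rw [hcross]
    have : ∑ i, ∑ j, wordMatrix M (w.take s) j j * wordMatrix M (w.drop (s + 1)) i i =
        (N * N) • (wordTrace M (w.take s) * wordTrace M (w.drop (s + 1))) := by
      simp_rw [← Finset.sum_mul, ← Finset.mul_sum]
      change (wordMatrix M (w.take s)).trace * (wordMatrix M (w.drop (s + 1))).trace = _
      rw [htr, htr, smul_mul_smul_comm]
    rw [this, smul_add, smul_add, smul_smul, smul_smul, smul_smul]
    congr 2 <;> field_simp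
  -- Removing a letter opens the cyclic word `x` into `drop ++ take`, which is glued to `w` in
  -- either orientation.
  have hone (x : List I) : ∑ i, ∑ j, wordMatrix M w j i * D r i j (wordTrace M x) =
      ∑ s : Fin x.length, (N⁻¹ * V r (x.get s)) •
        (wordTrace M (w ++ (x.drop (s + 1) ++ x.take s)) +
          wordTrace M (w ++ (x.drop (s + 1) ++ x.take s).reverse)) := by
    have h (i j : n) : D r i j (wordTrace M x) = N⁻¹ • ∑ s : Fin x.length,
        (N⁻¹ * V r (x.get s)) •
          (wordMatrix M (x.drop (s + 1) ++ x.take s) j i +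
            wordMatrix M (x.drop (s + 1) ++ x.take s) i j) := by
      simp only [wordTrace, Derivation.map_smul, Matrix.trace, map_sum, Matrix.diag_apply]
      congr 1
      simp only [derivation_wordMatrix (D r i j) (c := fun r' => N⁻¹ * V r r')
        (fun r' k l => hD r i j r' k l)]
      rw [Finset.sum_comm]
      refine Finset.sum_congr rfl fun s _ => ?_
      simp only [← Finset.smul_sum, Finset.sum_add_distrib, wordMatrix_append, Matrix.mul_apply]
      congr 2 <;> exact Finset.sum_congr rfl fun k _ => mul_comm _ _
    simp only [h, mul_smul_comm, Finset.mul_sum, ← Finset.smul_sum, mul_add]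
    simp_rw [Finset.sum_comm (s := (Finset.univ : Finset n)) (t := (Finset.univ : Finset (Fin _)))]
    simp only [← Finset.smul_sum, Finset.sum_add_distrib, hcross, hstraight]
    rw [Finset.smul_sum]
    refine Finset.sum_congr rfl fun s _ => ?_
    rw [← smul_add, smul_smul, smul_smul, add_comm]
    congr 1
    field_simp
  set G : R := (L.map (wordTrace M)).prod with hG
  -- Integration by parts on the leading entry; the Leibniz rule separates its own trace from the
  -- others.
  have hstart : E (((r :: w) :: L).map (wordTrace M)).prod =
      N⁻¹ * E ((∑ i, ∑ j, D r i j (wordMatrix M w j i)) * G +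
        ∑ i, ∑ j, wordMatrix M w j i * D r i j G) := by
    have e : (((r :: w) :: L).map (wordTrace M)).prod =
        N⁻¹ • ∑ i, ∑ j, M r i j * (wordMatrix M w j i * G) := by
      simp only [List.map_cons, List.prod_cons, ← hG, wordTrace, wordMatrix, Matrix.trace,
        Matrix.diag_apply, Matrix.mul_apply, smul_mul_assoc, Finset.sum_mul, mul_assoc]
      rfl
    rw [e, map_smul, smul_eq_mul]
    simp only [map_sum, hE, Derivation.leibniz, smul_eq_mul, map_add, Finset.sum_mul,
      Finset.sum_add_distrib]
    rw [add_comm]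
    simp only [mul_comm G]
  have hG' : ∑ i, ∑ j, wordMatrix M w j i * D r i j G =
      ∑ t : Fin L.length, ((L.eraseIdx t).map (wordTrace M)).prod *
        ∑ s : Fin (L.get t).length, (N⁻¹ * V r ((L.get t).get s)) •
        (wordTrace M (w ++ ((L.get t).drop (s + 1) ++ (L.get t).take s)) +
          wordTrace M (w ++ ((L.get t).drop (s + 1) ++ (L.get t).take s).reverse)) := by
    simp only [hG, derivation_list_prod, Finset.mul_sum]
    simp_rw [Finset.sum_comm (s := (Finset.univ : Finset n)) (t := (Finset.univ : Finset (Fin _)))]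
    refine Finset.sum_congr rfl fun t _ => ?_
    rw [← Finset.mul_sum, ← hone, Finset.mul_sum]
    refine Finset.sum_congr rfl fun i _ => ?_
    rw [Finset.mul_sum]
    refine Finset.sum_congr rfl fun j _ => ?_
    ring
  rw [hstart, hself, hG', map_add, mul_add]
  congr 1
  · rw [Finset.sum_mul, map_sum, Finset.mul_sum]
    refine Finset.sum_congr rfl fun s _ => ?_
    simp only [List.map_cons, List.prod_cons, ← hG, smul_mul_assoc, add_mul, map_smul, map_add,
      smul_eq_mul, mul_assoc]
    field_simp
    ring
  · rw [map_sum, Finset.mul_sum, Finset.mul_sum]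
    refine Finset.sum_congr rfl fun t _ => ?_
    rw [Finset.mul_sum, map_sum, Finset.mul_sum, Finset.mul_sum]
    refine Finset.sum_congr rfl fun s _ => ?_
    simp only [List.map_cons, List.prod_cons, mul_comm (((L.eraseIdx t).map (wordTrace M)).prod),
      smul_mul_assoc, add_mul, map_smul, map_add, smul_eq_mul]
    ring

end LoopEquation

/-! ### Large-`N` limit of the loop equations. -/

section WordLimit

variable {I : Type*}

/-- The limiting moment of a word: the sum over non-crossing pairings of its letters, computed by
removing the pair of the first letter. -/
noncomputable def wordLimit (V : I → I → ℝ) : List I → ℝ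
  | [] => 1
  | r :: w => ∑ s : Fin w.length,
      V r (w.get s) * (wordLimit V (w.take s) * wordLimit V (w.drop (s + 1)))
termination_by w => w.length
decreasing_by all_goals simp

/-- A family of moments of lists of words that satisfies the Schwinger–Dyson equations
factorizes in the limit. -/
theorem tendsto_of_loop_equation {V : I → I → ℝ} {E : ℕ → List (List I) → ℝ}
    (h0 : ∀ N, 0 < N → E N [] = 1) (h1 : ∀ N, 0 < N → ∀ L, E N ([] :: L) = E N L)
    (hloop : ∀ N, 0 < N → ∀ r w L, E N ((r :: w) :: L) =
      ∑ s : Fin w.length, V r (w.get s) *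
        (E N (w.take s :: w.drop (s + 1) :: L) +
          (N : ℝ)⁻¹ * E N ((w.take s ++ (w.drop (s + 1)).reverse) :: L)) +
      ((N : ℝ)⁻¹) ^ 2 * ∑ t : Fin L.length, ∑ s : Fin (L.get t).length,
        V r ((L.get t).get s) *
        (E N ((w ++ (((L.get t).drop (s + 1)) ++ (L.get t).take s)) :: L.eraseIdx t) +
          E N ((w ++ (((L.get t).drop (s + 1)) ++ (L.get t).take s).reverse) :: L.eraseIdx t)))
    (L : List (List I)) :
    Tendsto (fun N => E N L) atTop (𝓝 (L.map (wordLimit V)).prod) := by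
  -- The extra 1 per word makes deleting an empty word decrease the weight; splitting still lowers
  -- it by 1, since two letters go and one word is gained.
  induction hm : (L.map fun w => w.length + 1).sum using Nat.strong_induction_on generalizing L with
  | _ m ih =>
  have hpos : ∀ᶠ N : ℕ in atTop, 0 < N := eventually_gt_atTop 0
  have hinv : Tendsto (fun N : ℕ => (N : ℝ)⁻¹) atTop (𝓝 0) := tendsto_inv_atTop_nhds_zero_nat
  match L with
  | [] =>
    refine tendsto_const_nhds.congr' ?_
    filter_upwards [hpos] with N hN
    simp [h0 N hN]
  | [] :: L =>
    have := ih _ (by rw [← hm]; simp) L rfl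
    have e : (([] :: L).map (wordLimit V)).prod = (L.map (wordLimit V)).prod := by
      simp [wordLimit]
    rw [e]
    refine this.congr' ?_
    filter_upwards [hpos] with N hN
    rw [h1 N hN]
  | (r :: w) :: L =>
    have herase (t : Fin L.length) : ((L.eraseIdx t).map fun w => w.length + 1).sum +
        ((L.get t).length + 1) = (L.map fun w => w.length + 1).sum := by
      have hp := (List.getElem_cons_eraseIdx_perm t.2).map (fun w : List I => w.length + 1)
      have := hp.sum_eq
      simp only [List.map_cons, List.sum_cons] at this
      rw [← this]; simp [add_comm]
    simp only [List.map_cons, List.sum_cons, List.length_cons] at hm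
    -- This is the right side of the loop equation with `N⁻¹` replaced by 0, so that limits can be
    -- taken term by term.
    have hlim : ((((r :: w) :: L).map (wordLimit V)).prod) =
        ∑ s : Fin w.length, V r (w.get s) *
        (((w.take s :: w.drop (s + 1) :: L).map (wordLimit V)).prod +
          0 * (((w.take s ++ (w.drop (s + 1)).reverse) :: L).map (wordLimit V)).prod) +
        0 ^ 2 * ∑ t : Fin L.length, ∑ s : Fin (L.get t).length,
          V r ((L.get t).get s) *
          ((((w ++ (((L.get t).drop (s + 1)) ++ (L.get t).take s)) ::
              L.eraseIdx t).map (wordLimit V)).prod +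
            (((w ++ (((L.get t).drop (s + 1)) ++ (L.get t).take s).reverse) ::
              L.eraseIdx t).map (wordLimit V)).prod) := by
      simp only [List.map_cons, List.prod_cons, wordLimit, Finset.sum_mul, zero_mul, add_zero,
        ne_eq, OfNat.ofNat_ne_zero, not_false_eq_true, zero_pow, mul_assoc]
    rw [hlim]
    refine Tendsto.congr' (EventuallyEq.symm (hpos.mono fun N hN => hloop N hN r w L)) ?_
    refine Tendsto.add (tendsto_finsetSum _ fun s _ => ?_)
      ((hinv.pow 2).mul (tendsto_finsetSum _ fun t _ => tendsto_finsetSum _ fun s _ => ?_))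
    · refine Tendsto.const_mul _ (Tendsto.add (ih _ ?_ _ rfl) (hinv.mul (ih _ ?_ _ rfl)))
      · rw [← hm]
        simp only [List.map_cons, List.sum_cons, List.length_take, List.length_drop]
        omega
      · rw [← hm]
        simp only [List.map_cons, List.sum_cons, List.length_take, List.length_drop,
          List.length_append, List.length_reverse]
        omega
    · refine Tendsto.const_mul _ (Tendsto.add (ih _ ?_ _ rfl) (ih _ ?_ _ rfl)) <;>
      · rw [← hm, ← herase t]
        simp only [List.map_cons, List.sum_cons, List.length_take, List.length_drop,
          List.length_append, List.length_reverse]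
        omega

/-- For a covariance that depends only on the difference of the indices, the limiting moments of
words of consecutive letters satisfy a recursion. -/
lemma wordLimit_consecutive (V : ℤ → ℝ) {M : ℕ → ℝ} (h0 : M 0 = 1)
    (hM : ∀ n, M (n + 1) = ∑ j ∈ Finset.range n, V (-(j + 1 : ℤ)) * (M j * M (n - (j + 1))))
    (s n : ℕ) :
    wordLimit (fun r r' : ℕ+ => V (((r : ℕ) : ℤ) - ((r' : ℕ) : ℤ)))
      ((List.range' s n).map Nat.succPNat) = M n := by
  induction n using Nat.strong_induction_on generalizing s with
  | _ n ih =>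
  match n with
  | 0 => simp [wordLimit, h0]
  | n + 1 =>
    rw [List.range'_succ, List.map_cons, wordLimit, hM, Finset.sum_range]
    refine Fintype.sum_equiv (finCongr (by simp)) _ _ fun j => ?_
    have hj : (j : ℕ) < n := by simpa using j.2
    simp only [← List.map_take, ← List.map_drop, List.take_range'_of_length_ge hj.le,
      List.drop_range', finCongr_apply, Fin.val_cast]
    rw [ih _ (by omega), ih _ (by omega)]
    congr 2
    simp
    ring

end WordLimit

/-! ### Recursion for non-crossing pairings. -/

section NonCrossing

/-- `w` is a non-crossing pairing of the finite set `A`, given as the set of its ordered pairs. -/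
structure IsNonCrossingPairingOn (A : Finset ℕ) (w : Finset (ℕ × ℕ)) : Prop where
  mem : ∀ e ∈ w, e.1 ∈ A ∧ e.2 ∈ A ∧ e.1 < e.2
  cover : ∀ x ∈ A, ∃ e ∈ w, e.1 = x ∨ e.2 = x
  eq_of_meet : ∀ e ∈ w, ∀ f ∈ w, (e.1 = f.1 ∨ e.1 = f.2 ∨ e.2 = f.1 ∨ e.2 = f.2) → e = f
  noncrossing : ∀ e ∈ w, ∀ f ∈ w, ¬ (e.1 < f.1 ∧ f.1 < e.2 ∧ e.2 < f.2)

open Classical in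
/-- The finite set of non-crossing pairings of `A`. -/
noncomputable def nonCrossingPairingsOn (A : Finset ℕ) : Finset (Finset (ℕ × ℕ)) :=
  (A ×ˢ A).powerset.filter (IsNonCrossingPairingOn A)

lemma mem_nonCrossingPairingsOn {A : Finset ℕ} {w : Finset (ℕ × ℕ)} :
    w ∈ nonCrossingPairingsOn A ↔ IsNonCrossingPairingOn A w := by
  simp only [nonCrossingPairingsOn, Finset.mem_filter, Finset.mem_powerset, and_iff_right_iff_imp]
  intro h e he
  exact Finset.mem_product.2 ⟨(h.mem e he).1, (h.mem e he).2.1⟩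

/-- Arbitrary intervals are needed because cutting a pairing leaves intervals not starting at 1.
"Exactly one pair" becomes `cover` together with `eq_of_meet`. -/
lemma isNonCrossingPairing_iff {n : ℕ} {w : Finset (ℕ × ℕ)} :
    IsNonCrossingPairing n w ↔ IsNonCrossingPairingOn (Finset.Ico 1 (1 + n)) w := by
  constructor
  · rintro ⟨h1, h2, h3⟩
    have hmem : ∀ e ∈ w, e.1 ∈ Finset.Icc 1 n ∧ e.2 ∈ Finset.Icc 1 n := fun e he => by
      have := h1 e he
      simp only [Finset.mem_Icc]; omega
    refine ⟨fun e he => ?_, fun x hx => ?_, fun e he f hf h => ?_, h3⟩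
    · have := h1 e he
      simp only [Finset.mem_Ico]; omega
    · obtain ⟨e, he⟩ := Finset.card_eq_one.1
        (h2 x (by simp only [Finset.mem_Ico] at hx; simp only [Finset.mem_Icc]; omega))
      have : e ∈ w.filter fun e => e.1 = x ∨ e.2 = x := by rw [he]; simp
      exact ⟨e, (Finset.mem_filter.1 this).1, (Finset.mem_filter.1 this).2⟩
    · have key (x : ℕ) (hx : x ∈ Finset.Icc 1 n) (he' : e.1 = x ∨ e.2 = x)
          (hf' : f.1 = x ∨ f.2 = x) : e = f :=
        Finset.card_le_one.1 (h2 x hx).le e (Finset.mem_filter.2 ⟨he, he'⟩) f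
          (Finset.mem_filter.2 ⟨hf, hf'⟩)
      rcases h with h | h | h | h
      · exact key e.1 (hmem e he).1 (Or.inl rfl) (Or.inl h.symm)
      · exact key e.1 (hmem e he).1 (Or.inl rfl) (Or.inr h.symm)
      · exact key e.2 (hmem e he).2 (Or.inr rfl) (Or.inl h.symm)
      · exact key e.2 (hmem e he).2 (Or.inr rfl) (Or.inr h.symm)
  · rintro ⟨h1, h2, h3, h4⟩
    refine ⟨fun e he => ?_, fun x hx => ?_, h4⟩
    · have := h1 e he
      simp only [Finset.mem_Ico] at this; omega
    · obtain ⟨e, he, hex⟩ := h2 x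
        (by simp only [Finset.mem_Icc] at hx; simp only [Finset.mem_Ico]; omega)
      refine Finset.card_eq_one.2 ⟨e, ?_⟩
      ext f
      simp only [Finset.mem_filter, Finset.mem_singleton]
      constructor
      · rintro ⟨hf, hfx⟩
        exact h3 f hf e he (by omega)
      · rintro rfl
        exact ⟨he, hex⟩

lemma nonCrossingPairings_eq (n : ℕ) :
    nonCrossingPairings n = nonCrossingPairingsOn (Finset.Ico 1 (1 + n)) := by
  ext w
  rw [mem_nonCrossingPairingsOn, ← isNonCrossingPairing_iff, nonCrossingPairings,
    Finset.mem_filter, and_iff_right_iff_imp]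
  intro h
  rw [Finset.mem_powerset]
  intro e he
  have := h.1 e he
  simp only [Finset.mem_product, Finset.mem_Icc]; omega

/-- The generating function of the non-crossing pairings of `A` by the total length of the pairs. -/
noncomputable def pairingSumOn (p : ℝ) (A : Finset ℕ) : ℝ :=
  ∑ w ∈ nonCrossingPairingsOn A, ∏ e ∈ w, p ^ (e.2 - e.1)

lemma pairingSumOn_add (p : ℝ) (a b c : ℕ) :
    pairingSumOn p (Finset.Ico (a + c) (b + c)) = pairingSumOn p (Finset.Ico a b) := by
  symm
  let f : ℕ × ℕ ↪ ℕ × ℕ := ⟨fun e => (e.1 + c, e.2 + c), fun e f h => by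
    simp only [Prod.mk.injEq, add_left_inj] at h; exact Prod.ext h.1 h.2⟩
  have hf1 (e) : (f e).1 = e.1 + c := rfl
  have hf2 (e) : (f e).2 = e.2 + c := rfl
  refine Finset.sum_bij (fun w _ => w.map f) (fun w hw => ?_) (fun w _ w' _ h => ?_)
    (fun w hw => ?_) (fun w _ => ?_)
  · rw [mem_nonCrossingPairingsOn] at hw ⊢
    obtain ⟨h1, h2, h3, h4⟩ := hw
    simp only [Finset.mem_Ico] at h1 h2
    constructor
    · simp only [Finset.mem_map, forall_exists_index, and_imp, Finset.mem_Ico]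
      rintro _ e he rfl
      have := h1 e he
      simp only [hf1, hf2]; omega
    · intro x hx
      simp only [Finset.mem_Ico] at hx
      obtain ⟨e, he, hex⟩ := h2 (x - c) (by omega)
      exact ⟨f e, Finset.mem_map_of_mem _ he, by
        simp only [hf1, hf2]; omega⟩
    · simp only [Finset.mem_map, forall_exists_index, and_imp]
      rintro _ e he rfl _ e' he' rfl h
      rw [h3 e he e' he' (by simp only [hf1, hf2] at h; omega)]
    · simp only [Finset.mem_map, forall_exists_index, and_imp]
      rintro _ e he rfl _ e' he' rfl h
      exact h4 e he e' he' (by simp only [hf1, hf2] at h; omega)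
  · exact Finset.map_injective f h
  · rw [mem_nonCrossingPairingsOn] at hw
    obtain ⟨h1, h2, h3, h4⟩ := hw
    simp only [Finset.mem_Ico] at h1 h2
    -- Truncation never occurs on `w`, whose points are all at least `a + c`.
    let g : ℕ × ℕ → ℕ × ℕ := fun e => (e.1 - c, e.2 - c)
    have hfg (e) (he : e ∈ w) : f (g e) = e := by
      have := h1 e he
      apply Prod.ext <;> simp only [hf1, hf2, g] <;> omega
    refine ⟨w.image g, ?_, ?_⟩
    · rw [mem_nonCrossingPairingsOn]
      constructor
      · simp only [Finset.mem_image, forall_exists_index, and_imp, Finset.mem_Ico]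
        rintro _ e he rfl
        have := h1 e he
        simp only [g]; omega
      · intro x hx
        simp only [Finset.mem_Ico] at hx
        obtain ⟨e, he, hex⟩ := h2 (x + c) (by omega)
        exact ⟨g e, Finset.mem_image_of_mem _ he, by simp only [g]; omega⟩
      · simp only [Finset.mem_image, forall_exists_index, and_imp]
        rintro _ e he rfl _ e' he' rfl h
        have := h1 e he
        have := h1 e' he'
        rw [h3 e he e' he' (by simp only [g] at h; omega)]
      · simp only [Finset.mem_image, forall_exists_index, and_imp]
        rintro _ e he rfl _ e' he' rfl h
        have := h1 e he
        have := h1 e' he'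
        exact h4 e he e' he' (by simp only [g] at h; omega)
    · ext e
      simp only [Finset.mem_map, Finset.mem_image, exists_exists_and_eq_and]
      constructor
      · rintro ⟨e, he, rfl⟩
        rwa [hfg e he]
      · exact fun he => ⟨e, he, hfg e he⟩
  · simp only [Finset.prod_map, hf1, hf2, Nat.add_sub_add_right]

lemma pairingSumOn_empty (p : ℝ) (a : ℕ) : pairingSumOn p (Finset.Ico a a) = 1 := by
  have : nonCrossingPairingsOn (Finset.Ico a a) = {∅} := by
    ext w
    rw [mem_nonCrossingPairingsOn, Finset.mem_singleton]
    constructor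
    · intro h
      refine Finset.eq_empty_of_forall_notMem fun e he => ?_
      simpa using (h.mem e he).1
    · rintro rfl
      constructor <;> simp
  rw [pairingSumOn, this]
  simp

lemma IsNonCrossingPairingOn.insert_union {a b c : ℕ} (hab : a < b) (hbc : b < c)
    {u v : Finset (ℕ × ℕ)} (hu : IsNonCrossingPairingOn (Finset.Ico (a + 1) b) u)
    (hv : IsNonCrossingPairingOn (Finset.Ico (b + 1) c) v) :
    IsNonCrossingPairingOn (Finset.Ico a c) (insert (a, b) (u ∪ v)) := by
  obtain ⟨u1, u2, u3, u4⟩ := hu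
  obtain ⟨v1, v2, v3, v4⟩ := hv
  simp only [Finset.mem_Ico] at u1 u2 v1 v2
  constructor
  · intro e he
    simp only [Finset.mem_insert, Finset.mem_union] at he
    simp only [Finset.mem_Ico]
    rcases he with rfl | he | he
    · omega
    · have := u1 e he; omega
    · have := v1 e he; omega
  · intro x hx
    simp only [Finset.mem_Ico] at hx
    rcases lt_trichotomy x b with h | h | h
    · rcases hx.1.eq_or_lt with h' | h'
      · exact ⟨(a, b), by simp, Or.inl h'⟩
      · obtain ⟨e, he, hex⟩ := u2 x ⟨h', h⟩
        exact ⟨e, by simp [he], hex⟩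
    · exact ⟨(a, b), by simp, Or.inr h.symm⟩
    · obtain ⟨e, he, hex⟩ := v2 x ⟨h, hx.2⟩
      exact ⟨e, by simp [he], hex⟩
  · intro e he f hf h
    simp only [Finset.mem_insert, Finset.mem_union] at he hf
    rcases he with rfl | he | he <;> rcases hf with rfl | hf | hf
    · rfl
    · have := u1 f hf; omega
    · have := v1 f hf; omega
    · have := u1 e he; omega
    · exact u3 e he f hf h
    · have := u1 e he; have := v1 f hf; omega
    · have := v1 e he; omega
    · have := v1 e he; have := u1 f hf; omega
    · exact v3 e he f hf h
  · intro e he f hf h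
    simp only [Finset.mem_insert, Finset.mem_union] at he hf
    rcases he with rfl | he | he <;> rcases hf with rfl | hf | hf
    · omega
    · have := u1 f hf; omega
    · have := v1 f hf; omega
    · have := u1 e he; omega
    · exact u4 e he f hf h
    · have := u1 e he; have := v1 f hf; omega
    · have := v1 e he; omega
    · have := v1 e he; have := u1 f hf; omega
    · exact v4 e he f hf h

/-- As `a` is the least point, a pair straddling `b` would start between `a` and `b` and cross `(a,
b)`. -/
lemma IsNonCrossingPairingOn.trichotomy {a b c : ℕ} {w : Finset (ℕ × ℕ)}
    (hw : IsNonCrossingPairingOn (Finset.Ico a c) w) (hab : (a, b) ∈ w) {e : ℕ × ℕ} (he : e ∈ w) :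
    e = (a, b) ∨ (a < e.1 ∧ e.1 < e.2 ∧ e.2 < b) ∨ (b < e.1 ∧ e.1 < e.2 ∧ e.2 < c) := by
  have h1 := hw.mem e he
  have h2 := hw.noncrossing _ hab e he
  have h3 := hw.eq_of_meet e he _ hab
  have h4 := hw.mem _ hab
  simp only [Finset.mem_Ico] at h1 h2 h3 h4
  by_cases h : e = (a, b)
  · exact Or.inl h
  · right
    have h5 : ¬ (e.1 = a ∨ e.1 = b ∨ e.2 = a ∨ e.2 = b) := fun h' => h (h3 h')
    omega

lemma IsNonCrossingPairingOn.inner {a b c : ℕ} {w : Finset (ℕ × ℕ)}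
    (hw : IsNonCrossingPairingOn (Finset.Ico a c) w) (hab : (a, b) ∈ w) :
    IsNonCrossingPairingOn (Finset.Ico (a + 1) b) (w.filter fun e => a < e.1 ∧ e.2 < b) := by
  have hb := hw.mem _ hab
  simp only [Finset.mem_Ico] at hb
  refine ⟨fun e he => ?_, fun x hx => ?_, fun e he f hf => ?_, fun e he f hf => ?_⟩
  · rw [Finset.mem_filter] at he
    have := hw.mem e he.1
    simp only [Finset.mem_Ico] at this ⊢; omega
  · simp only [Finset.mem_Ico] at hx
    obtain ⟨e, he, hex⟩ := hw.cover x (by simp only [Finset.mem_Ico]; omega)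
    refine ⟨e, Finset.mem_filter.2 ⟨he, ?_⟩, hex⟩
    rcases hw.trichotomy hab he with rfl | h | h
    · simp only at hex; omega
    · omega
    · omega
  · exact hw.eq_of_meet e (Finset.mem_filter.1 he).1 f (Finset.mem_filter.1 hf).1
  · exact hw.noncrossing e (Finset.mem_filter.1 he).1 f (Finset.mem_filter.1 hf).1

lemma IsNonCrossingPairingOn.outer {a b c : ℕ} {w : Finset (ℕ × ℕ)}
    (hw : IsNonCrossingPairingOn (Finset.Ico a c) w) (hab : (a, b) ∈ w) :
    IsNonCrossingPairingOn (Finset.Ico (b + 1) c) (w.filter fun e => b < e.1) := by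
  have hb := hw.mem _ hab
  simp only [Finset.mem_Ico] at hb
  refine ⟨fun e he => ?_, fun x hx => ?_, fun e he f hf => ?_, fun e he f hf => ?_⟩
  · rw [Finset.mem_filter] at he
    have := hw.mem e he.1
    simp only [Finset.mem_Ico] at this ⊢; omega
  · simp only [Finset.mem_Ico] at hx
    obtain ⟨e, he, hex⟩ := hw.cover x (by simp only [Finset.mem_Ico]; omega)
    refine ⟨e, Finset.mem_filter.2 ⟨he, ?_⟩, hex⟩
    rcases hw.trichotomy hab he with rfl | h | h
    · simp only at hex; omega
    · omega
    · omega
  · exact hw.eq_of_meet e (Finset.mem_filter.1 he).1 f (Finset.mem_filter.1 hf).1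
  · exact hw.noncrossing e (Finset.mem_filter.1 he).1 f (Finset.mem_filter.1 hf).1

-- Cutting `w` into the pairs under `(a, b)` and those to its right is inverse to gluing, and the
-- weight is multiplicative.
open Classical in
lemma sum_nonCrossingPairingsOn_with_pair (p : ℝ) {a b c : ℕ} (hab : a < b) (hbc : b < c) :
    ∑ w ∈ (nonCrossingPairingsOn (Finset.Ico a c)).filter (fun w => (a, b) ∈ w),
      ∏ e ∈ w, p ^ (e.2 - e.1) =
    p ^ (b - a) * (pairingSumOn p (Finset.Ico (a + 1) b) *
      pairingSumOn p (Finset.Ico (b + 1) c)) := by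
  rw [pairingSumOn, pairingSumOn, Finset.sum_mul_sum, ← Finset.sum_product', Finset.mul_sum]
  refine Finset.sum_bij' (fun w _ => (w.filter fun e => a < e.1 ∧ e.2 < b,
    w.filter fun e => b < e.1)) (fun x _ => insert (a, b) (x.1 ∪ x.2)) ?_ ?_ ?_ ?_ ?_
  · intro w hw
    rw [Finset.mem_filter, mem_nonCrossingPairingsOn] at hw
    simp only [Finset.mem_product, mem_nonCrossingPairingsOn]
    exact ⟨hw.1.inner hw.2, hw.1.outer hw.2⟩
  · intro x hx
    simp only [Finset.mem_product, mem_nonCrossingPairingsOn] at hx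
    rw [Finset.mem_filter, mem_nonCrossingPairingsOn]
    exact ⟨hx.1.insert_union hab hbc hx.2, by simp⟩
  · intro w hw
    rw [Finset.mem_filter, mem_nonCrossingPairingsOn] at hw
    ext e
    simp only [Finset.mem_insert, Finset.mem_union, Finset.mem_filter]
    constructor
    · rintro (rfl | h | h)
      exacts [hw.2, h.1, h.1]
    · intro he
      have := hw.1.trichotomy hw.2 he
      tauto
  · rintro ⟨u, v⟩ hx
    simp only [Finset.mem_product, mem_nonCrossingPairingsOn] at hx
    have hu := hx.1.mem
    have hv := hx.2.mem
    simp only [Finset.mem_Ico] at hu hv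
    apply Prod.ext
    · ext e
      simp only [Finset.mem_insert, Finset.mem_union, Finset.mem_filter]
      constructor
      · rintro ⟨rfl | h | h, h'⟩
        · simp at h'
        · exact h
        · have := hv e h; omega
      · intro h
        have := hu e h
        exact ⟨Or.inr (Or.inl h), by omega⟩
    · ext e
      simp only [Finset.mem_insert, Finset.mem_union, Finset.mem_filter]
      constructor
      · rintro ⟨rfl | h | h, h'⟩
        · simp only at h'; omega
        · have := hu e h; omega
        · exact h
      · intro h
        have := hv e h
        exact ⟨Or.inr (Or.inr h), by omega⟩
  · intro w hw
    rw [Finset.mem_filter, mem_nonCrossingPairingsOn] at hw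
    have e : w = insert (a, b) ((w.filter fun e => a < e.1 ∧ e.2 < b) ∪
        w.filter fun e => b < e.1) := by
      ext e
      simp only [Finset.mem_insert, Finset.mem_union, Finset.mem_filter]
      constructor
      · intro he
        have := hw.1.trichotomy hw.2 he
        tauto
      · rintro (rfl | h | h)
        exacts [hw.2, h.1, h.1]
    conv_lhs => rw [e]
    rw [Finset.prod_insert, Finset.prod_union]
    · rw [Finset.disjoint_left]
      intro e he he'
      rw [Finset.mem_filter] at he he'
      have := hw.1.mem e he.1
      omega
    · simp only [Finset.mem_union, Finset.mem_filter]
      omega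

lemma pairingSumOn_succ (p : ℝ) (a n : ℕ) :
    pairingSumOn p (Finset.Ico a (a + (n + 1))) = ∑ j ∈ Finset.range n,
      p ^ (j + 1) * (pairingSumOn p (Finset.Ico (a + 1) (a + 1 + j)) *
        pairingSumOn p (Finset.Ico (a + 1 + j + 1) (a + (n + 1)))) := by
  classical
  -- Classify by the partner `a + 1 + j` of `a`, where `j` counts the points enclosed. The classes
  -- are disjoint because `a` has only one partner.
  have hsplit : nonCrossingPairingsOn (Finset.Ico a (a + (n + 1))) =
      (Finset.range n).biUnion fun j =>
        (nonCrossingPairingsOn (Finset.Ico a (a + (n + 1)))).filter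
          (fun w => (a, a + 1 + j) ∈ w) := by
    ext w
    simp only [Finset.mem_biUnion, Finset.mem_filter, Finset.mem_range]
    constructor
    · intro hw
      have hw' := mem_nonCrossingPairingsOn.1 hw
      obtain ⟨e, he, hex⟩ := hw'.cover a (by simp)
      have h1 := hw'.mem e he
      simp only [Finset.mem_Ico] at h1
      refine ⟨e.2 - (a + 1), by omega, hw, ?_⟩
      have : (a, a + 1 + (e.2 - (a + 1))) = e :=
        Prod.ext (by simp only; omega) (by simp only; omega)
      rwa [this]
    · rintro ⟨_, _, hw, _⟩
      exact hw
  conv_lhs => rw [pairingSumOn, hsplit]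
  rw [Finset.sum_biUnion]
  · refine Finset.sum_congr rfl fun j hj => ?_
    rw [Finset.mem_range] at hj
    rw [sum_nonCrossingPairingsOn_with_pair p (by omega) (by omega)]
    congr 2
    omega
  · intro j _ j' _ hjj'
    rw [Function.onFun, Finset.disjoint_left]
    intro w hw hw'
    rw [Finset.mem_filter, mem_nonCrossingPairingsOn] at hw hw'
    have := hw.1.eq_of_meet _ hw.2 _ hw'.2 (Or.inl rfl)
    simp only [Prod.mk.injEq] at this
    omega

/-- The generating function of the non-crossing pairings of `n` consecutive integers. -/
noncomputable def pairingGF (p : ℝ) (n : ℕ) : ℝ :=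
  ∑ w ∈ nonCrossingPairings n, ∏ e ∈ w, p ^ (e.2 - e.1)

lemma pairingSumOn_Ico (p : ℝ) (a n : ℕ) :
    pairingSumOn p (Finset.Ico a (a + n)) = pairingGF p n := by
  rw [pairingGF, nonCrossingPairings_eq, ← pairingSumOn]
  have h1 := pairingSumOn_add p 0 n a
  have h2 := pairingSumOn_add p 0 n 1
  rw [zero_add, add_comm] at h1 h2
  rw [h1, h2]

lemma pairingGF_zero (p : ℝ) : pairingGF p 0 = 1 := by
  rw [← pairingSumOn_Ico p 0, pairingSumOn_empty]

lemma pairingGF_succ (p : ℝ) (n : ℕ) :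
    pairingGF p (n + 1) = ∑ j ∈ Finset.range n,
      p ^ (j + 1) * (pairingGF p j * pairingGF p (n - (j + 1))) := by
  rw [← pairingSumOn_Ico p 0, pairingSumOn_succ]
  refine Finset.sum_congr rfl fun j hj => ?_
  rw [Finset.mem_range] at hj
  rw [pairingSumOn_Ico]
  have : 0 + (n + 1) = 0 + 1 + j + 1 + (n - (j + 1)) := by omega
  rw [this, pairingSumOn_Ico]

/-- The two interval lengths in each term of the recursion add up to `n - 2`, so one of them is odd.
-/
lemma pairingGF_odd (p : ℝ) {n : ℕ} (hn : Odd n) : pairingGF p n = 0 := by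
  induction n using Nat.strong_induction_on with
  | _ n ih =>
  obtain ⟨k, rfl⟩ := hn
  rw [pairingGF_succ]
  refine Finset.sum_eq_zero fun j hj => ?_
  rw [Finset.mem_range] at hj
  rcases Nat.even_or_odd j with h | h
  · rw [ih (2 * k - (j + 1)) (by omega) (by
      obtain ⟨i, rfl⟩ := h; exact ⟨k - i - 1, by omega⟩)]
    simp
  · rw [ih j (by omega) h]
    simp

lemma pairingSum_eq_pairingGF (k : ℕ) (p : ℝ) : pairingSum k p = pairingGF p (2 * k) := rfl

lemma pairingSum_zero (p : ℝ) : pairingSum 0 p = 1 := pairingGF_zero p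

lemma pairingSum_succ (k : ℕ) (p : ℝ) :
    pairingSum (k + 1) p = ∑ i ∈ Finset.range (k + 1),
      p ^ (2 * i + 1) * (pairingSum i p * pairingSum (k - i) p) := by
  simp only [pairingSum_eq_pairingGF]
  rw [show 2 * (k + 1) = 2 * k + 1 + 1 by ring, pairingGF_succ]
  symm
  -- Only even `j = 2 * i` contribute; an odd number of enclosed points cannot be paired.
  refine Finset.sum_of_injOn (fun i => 2 * i) (fun i _ j _ h => by simpa using h) ?_ ?_ ?_
  · intro i hi
    simp only [Finset.coe_range, Set.mem_Iio] at hi ⊢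
    omega
  · intro j hj hj'
    have : Odd j := by
      rw [← Nat.not_even_iff_odd]
      rintro ⟨i, rfl⟩
      rw [Finset.mem_range] at hj
      exact hj' ⟨i, by simp; omega, by simp; ring⟩
    rw [pairingGF_odd p this]
    simp
  · intro i hi
    rw [Finset.mem_range] at hi
    congr 3
    omega

/-! ### Comparison with `phi` and the `q`-Catalan numbers. -/

lemma phi_succ (k : ℕ) (x : ℝ) :
    phi (k + 1) x = ∑ i ∈ Finset.range (k + 1), x ^ i * phi i x * phi (k - i) x := by
  rw [phi, Finset.sum_range]

lemma qCatalan_succ (n : ℕ) (q : ℝ) :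
    qCatalan (n + 1) q = ∑ i ∈ Finset.range (n + 1),
      q ^ ((i + 1) * (n - i)) * qCatalan i q * qCatalan (n - i) q := by
  rw [qCatalan, Finset.sum_range]

lemma pairingSum_eq_phi (k : ℕ) (p : ℝ) : pairingSum k p = p ^ k * phi k (p ^ 2) := by
  induction k using Nat.strong_induction_on with
  | _ k ih =>
  match k with
  | 0 => simp [pairingSum_zero, phi]
  | k + 1 =>
    rw [pairingSum_succ, phi_succ, Finset.mul_sum]
    refine Finset.sum_congr rfl fun i hi => ?_
    rw [Finset.mem_range] at hi
    obtain ⟨j, rfl⟩ : ∃ j, k = i + j := ⟨k - i, by omega⟩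
    rw [ih i (by omega), ih (i + j - i) (by omega), Nat.add_sub_cancel_left]
    ring

lemma qCatalan_inv_eq_phi {p : ℝ} (hp : p ≠ 0) (k : ℕ) :
    qCatalan k p⁻¹ = phi k p / p ^ (k.choose 2) := by
  induction k using Nat.strong_induction_on with
  | _ k ih =>
  match k with
  | 0 => simp [qCatalan, phi]
  | k + 1 =>
    rw [qCatalan_succ, phi_succ, Finset.sum_div]
    refine Finset.sum_congr rfl fun i hi => ?_
    rw [Finset.mem_range] at hi
    obtain ⟨j, rfl⟩ : ∃ j, k = i + j := ⟨k - i, by omega⟩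
    rw [ih i (by omega), ih (i + j - i) (by omega), Nat.add_sub_cancel_left]
    -- The normalization by `p ^ (k.choose 2)` turns the Carlitz–Riordan weight `q ^ ((i + 1) * j)`
    -- into the weight `p ^ i` of `phi`.
    have hc : (i + 1) * j + i.choose 2 + j.choose 2 + i = (i + j + 1).choose 2 := by
      rw [← Nat.cast_inj (R := ℚ)]
      push_cast [Nat.cast_choose_two]
      ring
    rw [← hc, pow_add, pow_add, pow_add, inv_pow]
    field_simp

end NonCrossing

/-! ### The ensemble as an evaluation of generic polynomial matrices. -/

section CorrelatedGOE

open MvPolynomial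

/-- The upper triangular entries of the normalized matrices, as a process. -/
noncomputable def entryProcess {Ω : Type*} {N : ℕ} (a : ℕ+ → Fin N → Fin N → Ω → ℝ)
    (t : ℕ+ × Sym2 (Fin N)) (ω : Ω) : ℝ :=
  (1 / Real.sqrt N) * a t.1 t.2.inf t.2.sup ω

/-- The symmetric matrices of variables. -/
noncomputable def genericMatrix (N : ℕ) (r : ℕ+) :
    Matrix (Fin N) (Fin N) (MvPolynomial (ℕ+ × Sym2 (Fin N)) ℝ) :=
  Matrix.of fun i j => X (r, s(i, j))

lemma genericMatrix_transpose (N : ℕ) (r : ℕ+) :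
    (genericMatrix N r).transpose = genericMatrix N r := by
  ext1 i j
  simp [genericMatrix, Sym2.eq_swap]

variable {Ω : Type*} [MeasurableSpace Ω] {P : Measure Ω} {V : ℤ → ℝ} {N : ℕ}
  {a : ℕ+ → Fin N → Fin N → Ω → ℝ}

/-- Indexing by `Sym2` makes the entries `(i, j)` and `(j, i)` one variable, matching the Gaussian
hypothesis on `i ≤ j`. -/
lemma IsCorrelatedGOE.entryProcess_mk (ha : IsCorrelatedGOE P V N a) (r : ℕ+) (i j : Fin N)
    (ω : Ω) : entryProcess a (r, s(i, j)) ω = normalizedMatrix a r ω i j := by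
  simp only [entryProcess, normalizedMatrix, Matrix.of_apply, Sym2.inf_mk, Sym2.sup_mk]
  rcases le_total i j with h | h
  · simp [h]
  · simp [h, ha.symm r j i]

lemma IsCorrelatedGOE.gaussian_entries (ha : IsCorrelatedGOE P V N a) :
    IsGaussianProcess (entryProcess a) P := by
  have h := (ha.gaussian.comp_right (fun t : ℕ+ × Sym2 (Fin N) =>
    (⟨(t.1, t.2.inf, t.2.sup), Sym2.inf_le_sup t.2⟩ :
      {t : ℕ+ × Fin N × Fin N // t.2.1 ≤ t.2.2}))).smul (fun _ => 1 / Real.sqrt N)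
  exact h

lemma IsCorrelatedGOE.integral_entry (ha : IsCorrelatedGOE P V N a)
    (t : ℕ+ × Sym2 (Fin N)) : ∫ ω, entryProcess a t ω ∂P = 0 := by
  simp [entryProcess, integral_const_mul, ha.mean_zero]

lemma IsCorrelatedGOE.integral_entryProcess_mul (ha : IsCorrelatedGOE P V N a) (r r' : ℕ+)
    (i j k l : Fin N) :
    ∫ ω, entryProcess a (r, s(i, j)) ω * entryProcess a (r', s(k, l)) ω ∂P =
      (N : ℝ)⁻¹ * V (((r : ℕ) : ℤ) - ((r' : ℕ) : ℤ)) *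
        ((if i = k then 1 else 0) * (if j = l then 1 else 0) +
          (if i = l then 1 else 0) * (if k = j then 1 else 0)) := by
  have hN : (1 / Real.sqrt N) * (1 / Real.sqrt N) = (N : ℝ)⁻¹ := by
    rw [div_mul_div_comm, Real.mul_self_sqrt (Nat.cast_nonneg N), one_mul, one_div]
  simp only [ha.entryProcess_mk, normalizedMatrix, Matrix.of_apply]
  simp_rw [mul_mul_mul_comm _ (a r i j _), hN]
  rw [integral_const_mul, ha.covariance, mul_assoc]

lemma IsCorrelatedGOE.eval_wordTrace (ha : IsCorrelatedGOE P V N a) (m : ℕ) (ω : Ω) :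
    eval (fun t => entryProcess a t ω)
      (wordTrace (genericMatrix N) ((List.range' 0 m).map Nat.succPNat)) =
      normalizedTraceProd a m ω := by
  have hgen (r : ℕ+) : (eval (fun t => entryProcess a t ω)).mapMatrix (genericMatrix N r) =
      normalizedMatrix a r ω := by
    ext i j
    simp [genericMatrix, ha.entryProcess_mk]
  have hlist : ((List.range' 0 m).map Nat.succPNat).map (fun r => normalizedMatrix a r ω) =
      List.ofFn fun s : Fin m => normalizedMatrix a (Nat.succPNat s) ω := by
    apply List.ext_getElem <;> simp
  rw [normalizedTraceProd, wordTrace, smul_eval, Fintype.card_fin, one_div]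
  congr 1
  rw [AddMonoidHom.map_trace (eval (fun t => entryProcess a t ω)), ← hlist]
  congr 1
  change (eval (fun t => entryProcess a t ω)).mapMatrix _ = _
  rw [wordMatrix, map_list_prod, List.map_map]
  congr 2
  funext r
  exact hgen r

lemma IsCorrelatedGOE.integrable_normalizedTraceProd (ha : IsCorrelatedGOE P V N a) (m : ℕ) :
    Integrable (normalizedTraceProd a m) P := by
  have := ha.gaussian_entries.integrable_eval
    (wordTrace (genericMatrix N) ((List.range' 0 m).map Nat.succPNat))
  simpa only [ha.eval_wordTrace] using! this

end CorrelatedGOE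

/-! ### Convergence of the moments and the main theorem. -/

/-- The mixed moments of the matrices of a correlated family converge to the limiting moments of
words. -/
theorem tendsto_integral_normalizedTraceProd {Ω : ℕ → Type*} {mΩ : ∀ N, MeasurableSpace (Ω N)}
    {P : ∀ N, Measure (Ω N)} {V : ℤ → ℝ} {a : ∀ N, ℕ+ → Fin N → Fin N → Ω N → ℝ}
    (ha : ∀ N, IsCorrelatedGOE (P N) V N (a N)) (m : ℕ) :
    Tendsto (fun N => ∫ ω, normalizedTraceProd (a N) m ω ∂(P N)) atTop
      (𝓝 (wordLimit (fun r r' : ℕ+ => V (((r : ℕ) : ℤ) - ((r' : ℕ) : ℤ)))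
        ((List.range' 0 m).map Nat.succPNat))) := by
  have hG (N : ℕ) := (ha N).gaussian_entries
  have key := tendsto_of_loop_equation
    (V := fun r r' : ℕ+ => V (((r : ℕ) : ℤ) - ((r' : ℕ) : ℤ)))
    (E := fun N L => (hG N).expectation (L.map (wordTrace (genericMatrix N))).prod)
    ?_ ?_ ?_ [(List.range' 0 m).map Nat.succPNat]
  · simp only [List.map_cons, List.map_nil, List.prod_singleton] at key
    refine key.congr fun N => ?_
    exact integral_congr_ae (ae_of_all _ fun ω => (ha N).eval_wordTrace m ω)
  · intro N _
    have := (hG N).isProbabilityMeasure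
    simp [IsGaussianProcess.expectation]
  -- Positivity of `N` matters: for `N = 0` the normalized trace of the empty word is 0, not 1.
  · intro N hN L
    have : Nonempty (Fin N) := ⟨⟨0, hN⟩⟩
    simp [wordTrace_nil]
  · intro N hN r w L
    have : Nonempty (Fin N) := ⟨⟨0, hN⟩⟩
    have h := loop_equation (n := Fin N) (M := genericMatrix N)
      (V := fun r r' : ℕ+ => V (((r : ℕ) : ℤ) - ((r' : ℕ) : ℤ)))
      (genericMatrix_transpose N)
      (fun r i j => covDerivation (P N) (entryProcess (a N)) (r, s(i, j))) ?_
      (hG N).expectation ?_ r w L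
    · simpa only [Fintype.card_fin] using h
    · intro r i j r' k l
      rw [genericMatrix, Matrix.of_apply, covDerivation, MvPolynomial.mkDerivation_X,
        (ha N).integral_entryProcess_mul, Fintype.card_fin]
      rfl
    · intro r i j F
      exact (hG N).expectation_X_mul (ha N).integral_entry _ F

theorem theorem1p1 (p : ℝ) (hp0 : 0 < p) (hp1 : p < 1) :
    -- existence of the moments and convergence, for every such matrix ensemble
    (∀ (Ω : ℕ → Type*) (mΩ : ∀ N, MeasurableSpace (Ω N)) (P : ∀ N, Measure (Ω N))
        (_hP : ∀ N, IsProbabilityMeasure (P N))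
        (a : ∀ N, ℕ+ → Fin N → Fin N → Ω N → ℝ)
        (_ha : ∀ N, IsCorrelatedGOE (P N) (fun d : ℤ => p ^ d.natAbs) N (a N)) (k : ℕ),
        (∀ N, Integrable (normalizedTraceProd (a N) (2 * k)) (P N)) ∧
          Tendsto (fun N : ℕ => ∫ ω, normalizedTraceProd (a N) (2 * k) ω ∂(P N)) atTop
            (𝓝 (pairingSum k p))) ∧
    -- recurrence for the limits
    (pairingSum 0 p = 1 ∧
      ∀ k : ℕ, pairingSum (k + 1) p =
        ∑ i ∈ Finset.Icc 1 (k + 1),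
          p ^ (2 * i - 1) * pairingSum (i - 1) p * pairingSum (k + 1 - i) p) ∧
    -- expression of the limits through `φ`, and of `φ` through the `q`-Catalan numbers
    (∀ k : ℕ, pairingSum k p = p ^ k * phi k (p ^ 2)) ∧
    (∀ k : ℕ, qCatalan k p⁻¹ = phi k p / p ^ (k.choose 2)) := by
  refine ⟨fun Ω mΩ P _ a ha k => ⟨fun N => (ha N).integrable_normalizedTraceProd _, ?_⟩,
    ⟨pairingSum_zero p, fun k => ?_⟩, fun k => pairingSum_eq_phi k p,
    qCatalan_inv_eq_phi hp0.ne'⟩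
  · have h := tendsto_integral_normalizedTraceProd ha (2 * k)
    -- The sequence `M` is `pairingGF p`; the first letter and its partner differ by `-(j + 1)`,
    -- giving the weight `p ^ (j + 1)`.
    rwa [wordLimit_consecutive (fun d : ℤ => p ^ d.natAbs) (pairingGF_zero p) fun n => ?_] at h
    rw [pairingGF_succ]
    refine Finset.sum_congr rfl fun j _ => ?_
    rw [Int.natAbs_neg]
    rfl
  · rw [pairingSum_succ]
    refine Finset.sum_nbij' (· + 1) (· - 1) ?_ ?_ ?_ ?_ fun i _ => ?_
    · simp
    · simp only [Finset.mem_Icc, Finset.mem_range]; omega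
    · simp
    · simp only [Finset.mem_Icc]; omega
    · rw [Nat.add_sub_cancel, Nat.add_sub_add_right, mul_assoc]
      congr 2
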